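/- Let $R$ be an associative ring with identity. For right $R$-modules $M,N$, call $M$ almost $N$-injective if for every submodule $N'\subseteq N$, with inclusion $\iota:N'\to N$, and every homomorphism $f:N'\to M$, either there is a homomorphism $g:N\to M$ with $f=g\iota$, or there are a nonzero idempotent $\pi\in\operatorname{End}_R(N)$ and a homomorphism $h:M\to\pi(N)$ with $hf=\pi\iota$. Call $M$ almost injective if it is almost $N$-injective for every right $R$-module $N$, and call $R$ a right almost $V$-ring if every simple right $R$-module is almost injective. A module is a $V$-module if each of its proper submodules is an intersection of maximal submodules, and a ring is a right $V$-ring if it is a $V$-module as a right module over itself. A module is local if it has a largest proper submodule, and $J(\cdot)$ denotes the Jacobson radical of a module or of a ring. Then the following assertions are equivalent: 1) $R$ is a right almost $V$-ring. 2) Every right $R$-module either is a $V$-module or contains a nonzero direct summand which is a projective module (both may happen). 3) There exists a (possibly empty or infinite) set of orthogonal idempotents $\{e_i\}_{i\in I}$ of $R$ such that a) $e_iR$ is a local injective right $R$-module of length two for every $i\in I$; b) $J(R)=\bigoplus_{i\in I}J(e_iR)$ as an internal direct sum of right ideals of $R$; c) $R/J(R)$ is a right $V$-ring. -/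

import Mathlib

universe u

/-!
Right modules over a ring `R` are `Module Rᵐᵒᵖ M`, with `m · r = MulOpposite.op r • m`. The module
notions below are stated for left modules over an arbitrary ring `A` and are used with `A = Rᵐᵒᵖ`.
-/

/-- `M` is almost `N`-injective: every homomorphism `f : N' → M` from a submodule `N'` of `N`
either extends to `N`, or there are a nonzero idempotent `π ∈ End(N)` and a homomorphism
`h : M → π(N)` such that `h ∘ f` is the restriction of `π` to `N'`. -/
def IsAlmostInjectiveRel (A M N : Type u) [Ring A] [AddCommGroup M] [Module A M]
    [AddCommGroup N] [Module A N] : Prop :=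
  ∀ (N' : Submodule A N) (f : N' →ₗ[A] M),
    (∃ g : N →ₗ[A] M, f = g ∘ₗ N'.subtype) ∨
    (∃ π : Module.End A N, IsIdempotentElem π ∧ π ≠ 0 ∧
      ∃ h : M →ₗ[A] LinearMap.range π, h ∘ₗ f = π.rangeRestrict ∘ₗ N'.subtype)

/-- `M` is almost injective: it is almost `N`-injective for every module `N`. -/
def IsAlmostInjective (A M : Type u) [Ring A] [AddCommGroup M] [Module A M] : Prop :=
  ∀ (N : Type u) [AddCommGroup N] [Module A N], IsAlmostInjectiveRel A M N

/-- `M` is a V-module (cosemisimple): every proper submodule of `M` is an intersection of maximal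
submodules of `M`. -/
def IsVModule (A M : Type u) [Ring A] [AddCommGroup M] [Module A M] : Prop :=
  ∀ N : Submodule A M, N ≠ ⊤ →
    ∃ S : Set (Submodule A M), (∀ K ∈ S, IsCoatom K) ∧ N = sInf S

/-- `M` is a local module: it has a largest proper submodule. -/
def IsLocalModule (A M : Type u) [Ring A] [AddCommGroup M] [Module A M] : Prop :=
  ∃ N : Submodule A M, N ≠ ⊤ ∧ ∀ K : Submodule A M, K ≠ ⊤ → K ≤ N

/-- `R` is a right V-ring: `R`, as a right module over itself, is a V-module. -/
def IsRightVRing (R : Type u) [Ring R] : Prop :=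
  IsVModule Rᵐᵒᵖ R

/-- `R` is a right almost V-ring: every simple right `R`-module is almost injective. -/
def IsRightAlmostVRing (R : Type u) [Ring R] : Prop :=
  ∀ (S : Type u) [AddCommGroup S] [Module Rᵐᵒᵖ S], IsSimpleModule Rᵐᵒᵖ S →
    IsAlmostInjective Rᵐᵒᵖ S

/-- The principal right ideal `eR`, as a submodule of the right module `R`. -/
def principalRightIdeal {R : Type u} [Ring R] (e : R) : Submodule Rᵐᵒᵖ R :=
  Submodule.span Rᵐᵒᵖ {e}

theorem mem_principalRightIdeal {R : Type u} [Ring R] {e x : R} :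
    x ∈ principalRightIdeal e ↔ ∃ r : R, x = e * r := by
  unfold principalRightIdeal
  rw [Submodule.mem_span_singleton]
  constructor
  · rintro ⟨a, rfl⟩
    exact ⟨a.unop, rfl⟩
  · rintro ⟨r, rfl⟩
    exact ⟨MulOpposite.op r, rfl⟩

/-- The Jacobson radical `J(P)` of a submodule `P` of `M` (the intersection of the maximal
submodules of `P`), regarded as a submodule of `M`. -/
def radicalOf {A M : Type u} [Ring A] [AddCommGroup M] [Module A M] (P : Submodule A M) :
    Submodule A M :=
  (Module.jacobson A P).map P.subtype

/-! All three conditions are equivalent to `MonolithicProjective`. A submodule maximal among those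
avoiding a given element has a quotient with a monolith, so it is either a maximal submodule or,
under `MonolithicProjective`, a direct summand. This dichotomy yields condition 2 and the almost
injectivity of simple modules. Conversely, a module with a monolith is uniform, so it equals any
nonzero direct summand, and it is no V-module if the monolith is proper. For almost injectivity, map
a free module onto it and apply the definition to the preimage of the monolith.

Under `MonolithicProjective`, a module with a proper monolith is injective of length two
(`injective_and_isCoatom`). A maximal independent family of such right ideals consists of the `e i
R`. Their radicals sum to `J(R)`, since otherwise the dichotomy splits off a further one.
Conversely, let `U` have a proper monolith. If `U J(R) = 0`, the V-ring `R/J(R)` forces the monolith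
to be all of `U`. Otherwise some `e i R` embeds in `U`, splits off by injectivity, and equals `U` by
uniformity. -/

/-- `S` is the monolith of `M`: a nonzero submodule contained in every nonzero submodule. -/
def IsMonolith {A M : Type u} [Ring A] [AddCommGroup M] [Module A M] (S : Submodule A M) : Prop :=
  S ≠ ⊥ ∧ ∀ N : Submodule A M, N ≠ ⊥ → S ≤ N

/-- Every module with a proper monolith is projective. -/
def MonolithicProjective (A : Type u) [Ring A] : Prop :=
  ∀ (U : Type u) [AddCommGroup U] [Module A U] (S : Submodule A U), IsMonolith S → S ≠ ⊤ →
    Module.Projective A U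

/-! ### Monoliths and quotients by submodules maximal without a given element -/

section Monolith

variable {A M N : Type u} [Ring A] [AddCommGroup M] [Module A M] [AddCommGroup N] [Module A N]

theorem IsMonolith.isAtom {S : Submodule A M} (hS : IsMonolith S) : IsAtom S :=
  ⟨hS.1, fun N hN => by
    by_contra h
    exact hN.not_ge (hS.2 N h)⟩

theorem IsMonolith.isSimpleModule {S : Submodule A M} (hS : IsMonolith S) :
    IsSimpleModule A S :=
  isSimpleModule_iff_isAtom.2 hS.isAtom

theorem IsMonolith.isSimpleModule_of_eq_top {S : Submodule A M} (hS : IsMonolith S)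
    (h : S = ⊤) : IsSimpleModule A M := by
  have := hS.isSimpleModule
  rw [h] at this
  exact IsSimpleModule.congr (Submodule.topEquiv (R := A) (M := M)).symm

/-- Uniformity, the form in which monoliths are mostly used: two nonzero submodules both contain
`S`. -/
theorem IsMonolith.eq_bot_of_disjoint {S P Q : Submodule A M} (hS : IsMonolith S)
    (h : Disjoint P Q) (hP : P ≠ ⊥) : Q = ⊥ := by
  by_contra hQ
  exact hS.1 (le_bot_iff.1 (h (hS.2 P hP) (hS.2 Q hQ)))

theorem IsMonolith.map_equiv {S : Submodule A M} (hS : IsMonolith S) (e : M ≃ₗ[A] N) :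
    IsMonolith (S.map (e : M →ₗ[A] N)) := by
  refine ⟨fun h => hS.1 ((Submodule.map_eq_bot_iff (e := e)).1 h), fun K hK => ?_⟩
  rw [Submodule.map_le_iff_le_comap]
  refine hS.2 _ fun h => hK ?_
  rw [← Submodule.map_comap_eq_of_surjective (f := (e : M →ₗ[A] N)) e.surjective K, h,
    Submodule.map_bot]

/-- Among the submodules containing `K` and avoiding `x` there is a maximal one. -/
theorem exists_maximal_notMem (K : Submodule A M) {x : M} (hx : x ∉ K) :
    ∃ C : Submodule A M, K ≤ C ∧ x ∉ C ∧ ∀ D : Submodule A M, C < D → x ∈ D := by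
  obtain ⟨C, hKC, hC⟩ := zorn_le_nonempty₀ {C : Submodule A M | x ∉ C} (by
    intro c hc hchain y hy
    refine ⟨sSup c, ?_, fun z hz => le_sSup hz⟩
    intro hxc
    rw [Submodule.mem_sSup_of_directed ⟨y, hy⟩ hchain.directedOn] at hxc
    obtain ⟨D, hD, hxD⟩ := hxc
    exact hc hD hxD) K hx
  refine ⟨C, hKC, hC.prop, fun D hD => ?_⟩
  by_contra h
  exact hD.not_ge (hC.le_of_ge h hD.le)

theorem isMonolith_quotient {C : Submodule A M} {x : M} (hx : x ∉ C)
    (hC : ∀ D : Submodule A M, C < D → x ∈ D) :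
    IsMonolith (Submodule.span A {C.mkQ x}) := by
  refine ⟨?_, fun N hN => ?_⟩
  · rw [Ne, Submodule.span_singleton_eq_bot]
    simpa using hx
  · rw [Submodule.span_singleton_le_iff_mem, ← Submodule.mem_comap]
    refine hC _ (lt_of_le_of_ne (Submodule.le_comap_mkQ C N) fun h => hN ?_)
    rw [← Submodule.map_comap_eq_of_surjective C.mkQ_surjective N, ← h, Submodule.mkQ_map_self]

/-- A submodule avoiding `x` lies in a submodule `C` avoiding `x` which is maximal in `M`, or for
which `M ⧸ C` has a proper monolith. -/
theorem exists_isCoatom_or_isMonolith (K : Submodule A M) {x : M} (hx : x ∉ K) :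
    ∃ C : Submodule A M, K ≤ C ∧ x ∉ C ∧
      (IsCoatom C ∨ ∃ S : Submodule A (M ⧸ C), IsMonolith S ∧ S ≠ ⊤) := by
  obtain ⟨C, hKC, hxC, hC⟩ := exists_maximal_notMem K hx
  refine ⟨C, hKC, hxC, ?_⟩
  have hm := isMonolith_quotient hxC hC
  by_cases h : Submodule.span A {C.mkQ x} = ⊤
  · exact .inl (isSimpleModule_iff_isCoatom.1 (hm.isSimpleModule_of_eq_top h))
  · exact .inr ⟨_, hm, h⟩

theorem isVModule_iff :
    IsVModule A M ↔ ∀ (K : Submodule A M) (x : M), x ∉ K → ∃ C, IsCoatom C ∧ K ≤ C ∧ x ∉ C := by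
  constructor
  · intro h K x hx
    obtain ⟨S, hS, rfl⟩ := h K (by rintro rfl; exact hx trivial)
    simp only [Submodule.mem_sInf, not_forall] at hx
    obtain ⟨C, hC, hxC⟩ := hx
    exact ⟨C, hS C hC, sInf_le hC, hxC⟩
  · intro h K _
    refine ⟨{C | IsCoatom C ∧ K ≤ C}, fun C hC => hC.1, le_antisymm (le_sInf fun C hC => hC.2) ?_⟩
    intro x hx
    by_contra hxK
    obtain ⟨C, hC, hKC, hxC⟩ := h K x hxK
    exact hxC ((Submodule.mem_sInf.1 hx) C ⟨hC, hKC⟩)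

/-- A submodule with projective quotient has a complement. -/
theorem exists_isCompl_of_projective_quotient (C : Submodule A M)
    [Module.Projective A (M ⧸ C)] : ∃ D : Submodule A M, IsCompl D C := by
  obtain ⟨s, hs⟩ := Module.projective_lifting_property C.mkQ LinearMap.id C.mkQ_surjective
  have hs' : ∀ y, C.mkQ (s y) = y := fun y => LinearMap.congr_fun hs y
  refine ⟨LinearMap.range s, Submodule.disjoint_def.2 ?_, codisjoint_iff_le_sup.2 fun x _ => ?_⟩
  · rintro _ ⟨y, rfl⟩ hy
    have h0 : C.mkQ (s y) = 0 := (Submodule.Quotient.mk_eq_zero C).2 hy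
    rw [← hs' y, h0, map_zero]
  · refine Submodule.mem_sup.2 ⟨s (C.mkQ x), ⟨_, rfl⟩, x - s (C.mkQ x), ?_, by simp⟩
    rw [← Submodule.Quotient.mk_eq_zero, ← Submodule.mkQ_apply, map_sub, hs', sub_self]

theorem IsMonolith.projective_of_summand {S P Q : Submodule A M} (hS : IsMonolith S)
    (hP : P ≠ ⊥) (h : IsCompl P Q) [Module.Projective A P] : Module.Projective A M := by
  have hQ := hS.eq_bot_of_disjoint h.disjoint hP
  have hPt : P = ⊤ := by simpa [hQ] using h.sup_eq_top
  subst hPt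
  exact Module.Projective.of_equiv (Submodule.topEquiv (R := A) (M := M))

/-- A maximal submodule missing a nonzero element of `S` must be zero, which would make `M` simple.
-/
theorem IsMonolith.not_isVModule {S : Submodule A M} (hS : IsMonolith S) (hS' : S ≠ ⊤) :
    ¬ IsVModule A M := by
  rw [isVModule_iff]
  intro h
  obtain ⟨x, hx, hx0⟩ := Submodule.exists_mem_ne_zero_of_ne_bot hS.1
  obtain ⟨C, hC, -, hxC⟩ := h ⊥ x (by simpa using hx0)
  have hC0 : C = ⊥ := by
    by_contra h
    exact hxC (hS.2 C h hx)
  subst hC0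
  exact hS' (hC.2 S hS.1.bot_lt)

end Monolith

/-! ### Almost injectivity, summands and projectivity of monolithic modules -/

section AlmostInjective

variable {A : Type u} [Ring A]

theorem LinearMap.exists_comp_eq_of_ker_le {M N P : Type u} [AddCommGroup M] [Module A M]
    [AddCommGroup N] [Module A N] [AddCommGroup P] [Module A P] {φ : M →ₗ[A] N}
    (hφ : Function.Surjective φ) (g : M →ₗ[A] P) (h : ∀ x, φ x = 0 → g x = 0) :
    ∃ ψ : N →ₗ[A] P, ∀ x, ψ (φ x) = g x := by
  refine ⟨(LinearMap.ker φ).liftQ g (fun x hx => h x hx) ∘ₗ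
    (φ.quotKerEquivOfSurjective hφ).symm.toLinearMap, fun x => ?_⟩
  have : (φ.quotKerEquivOfSurjective hφ).symm (φ x) = (LinearMap.ker φ).mkQ x := by
    rw [LinearEquiv.symm_apply_eq]; rfl
  rw [LinearMap.comp_apply, LinearEquiv.coe_coe, this]
  rfl

theorem IsMonolith.projective_of_isAlmostInjective {U F : Type u} [AddCommGroup U] [Module A U]
    [AddCommGroup F] [Module A F] [Module.Projective A F] {S : Submodule A U} (hS : IsMonolith S)
    (hSt : S ≠ ⊤) {φ : F →ₗ[A] U} (hφ : Function.Surjective φ)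
    (h : IsAlmostInjectiveRel A S F) : Module.Projective A U := by
  let f : S.comap φ →ₗ[A] S := φ.restrict fun x hx => hx
  rcases h (S.comap φ) f with ⟨g, hg⟩ | ⟨π, hπ, hπ0, k, hk⟩
  -- An extension `g` kills `ker φ`, so it induces a retraction of `U` onto `S`. The kernel of this
  -- retraction misses `S`, hence is zero, and `S` is everything.
  · exfalso
    have hker : LinearMap.ker φ ≤ LinearMap.ker g := by
      intro x hx
      have hxS : x ∈ S.comap φ := by simp [LinearMap.mem_ker.1 hx]
      have := LinearMap.congr_fun hg ⟨x, hxS⟩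
      rw [LinearMap.mem_ker, ← show f ⟨x, hxS⟩ = g x from this]
      exact Subtype.ext hx
    have hgs : ∀ x y, φ x = φ y → g x = g y := by
      intro x y hxy
      rw [← sub_eq_zero, ← map_sub]
      exact hker (by rw [LinearMap.mem_ker, map_sub, hxy, sub_self])
    have hgS : ∀ x, φ x ∈ S → (g x : U) = φ x := by
      intro x hx
      have := LinearMap.congr_fun hg ⟨x, hx⟩
      rw [← show f ⟨x, hx⟩ = g x from this]
      rfl
    refine hSt (eq_top_iff.2 fun u _ => ?_)
    have hkerg : (LinearMap.ker g).map φ = ⊥ := by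
      by_contra hne
      obtain ⟨x, hx, hx0⟩ := Submodule.exists_mem_ne_zero_of_ne_bot hS.1
      obtain ⟨y, hy, rfl⟩ := hS.2 _ hne hx
      have h1 := hgS y hx
      rw [LinearMap.mem_ker.1 hy] at h1
      exact hx0 h1.symm
    obtain ⟨x, rfl⟩ := hφ u
    obtain ⟨y, hy⟩ := hφ (g x)
    have hyx : g y = g x := Subtype.ext ((hgS y (by simp [hy])).trans hy)
    have hmem : φ (x - y) ∈ (LinearMap.ker g).map φ :=
      Submodule.mem_map_of_mem (by rw [LinearMap.mem_ker, map_sub, hyx, sub_self])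
    rw [hkerg, Submodule.mem_bot, map_sub, sub_eq_zero] at hmem
    rw [hmem, hy]
    exact (g x).2
  -- Here `π` kills `ker φ`, so `U` maps onto the projective module `π(F)`. This map splits and
  -- uniformity makes it an isomorphism.
  · have hker : LinearMap.ker φ ≤ LinearMap.ker π := by
      intro x hx
      have hxS : x ∈ S.comap φ := by simp [LinearMap.mem_ker.1 hx]
      have h1 := LinearMap.congr_fun hk ⟨x, hxS⟩
      have h2 : f ⟨x, hxS⟩ = 0 := Subtype.ext hx
      rw [LinearMap.comp_apply, h2, map_zero] at h1
      exact (congrArg Subtype.val h1).symm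
    have hsplit : π.rangeRestrict ∘ₗ (LinearMap.range π).subtype = LinearMap.id := by
      refine LinearMap.ext ?_
      rintro ⟨_, x, rfl⟩
      refine Subtype.ext (show π (π x) = π x from ?_)
      rw [← Module.End.mul_apply, hπ.eq]
    have hProj : Module.Projective A (LinearMap.range π) :=
      Module.Projective.of_split (LinearMap.range π).subtype π.rangeRestrict hsplit
    obtain ⟨ψ, hψφ⟩ := LinearMap.exists_comp_eq_of_ker_le hφ π.rangeRestrict
      fun x hx => Subtype.ext (hker hx)
    have hψ : Function.Surjective ψ := by
      rintro ⟨_, x, rfl⟩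
      exact ⟨φ x, hψφ x⟩
    obtain ⟨s, hs⟩ := Module.projective_lifting_property ψ LinearMap.id hψ
    have hs' : ∀ y, ψ (s y) = y := fun y => LinearMap.congr_fun hs y
    have hinj : LinearMap.ker ψ = ⊥ := by
      refine hS.eq_bot_of_disjoint (P := LinearMap.range s) ?_ ?_
      · rw [Submodule.disjoint_def]
        rintro _ ⟨y, rfl⟩ hy
        rw [LinearMap.mem_ker, hs'] at hy
        rw [hy, map_zero]
      · intro h0
        refine hπ0 (LinearMap.ext fun x => ?_)
        have h1 : s (π.rangeRestrict x) = 0 := by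
          rw [← Submodule.mem_bot A, ← h0]
          exact ⟨_, rfl⟩
        have h2 := hs' (π.rangeRestrict x)
        rw [h1, map_zero] at h2
        exact (congrArg Subtype.val h2).symm
    exact Module.Projective.of_equiv
      (LinearEquiv.ofBijective ψ ⟨LinearMap.ker_eq_bot.1 hinj, hψ⟩).symm

theorem monolithicProjective_of_almostInjective
    (h : ∀ (S : Type u) [AddCommGroup S] [Module A S], IsSimpleModule A S →
      IsAlmostInjective A S) : MonolithicProjective A := fun U _ _ S hS hSt =>
  hS.projective_of_isAlmostInjective hSt (Finsupp.linearCombination_id_surjective A U)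
    (h S hS.isSimpleModule (U →₀ A))

/-- Take `C` containing `ker f` and maximal without some `x` with `f x ≠ 0`; then `S` embeds in `N ⧸
C`. If `N ⧸ C` is simple the embedding is invertible and `f` extends. Otherwise `N ⧸ C` is
projective, and a section of `N → N ⧸ C` gives `π` and `h`. -/
theorem MonolithicProjective.isAlmostInjective (h : MonolithicProjective A) (S : Type u)
    [AddCommGroup S] [Module A S] (hS : IsSimpleModule A S) : IsAlmostInjective A S := by
  intro N _ _ N' f
  by_cases hf : f = 0
  · exact .inl ⟨0, by simp [hf]⟩
  have hfs : Function.Surjective f := LinearMap.surjective_of_ne_zero hf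
  obtain ⟨x, hx⟩ : ∃ x, f x ≠ 0 := by
    by_contra! hne
    exact hf (LinearMap.ext hne)
  have hxK : (x : N) ∉ (LinearMap.ker f).map N'.subtype := by
    rintro ⟨y, hy, hyx⟩
    exact hx (by rw [← Subtype.ext hyx]; exact hy)
  obtain ⟨C, hKC, hxC, hC⟩ := exists_maximal_notMem _ hxK
  have hm := isMonolith_quotient hxC hC
  obtain ⟨j, hj⟩ : ∃ j : S →ₗ[A] N ⧸ C, ∀ y, j (f y) = C.mkQ y :=
    LinearMap.exists_comp_eq_of_ker_le hfs (C.mkQ ∘ₗ N'.subtype) fun y hy => by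
      simpa using hKC ⟨y, hy, rfl⟩
  have hj0 : j ≠ 0 := by
    intro h0
    have := hj x
    rw [h0, LinearMap.zero_apply] at this
    exact hxC (by simpa using this.symm)
  by_cases ht : Submodule.span A {C.mkQ (x : N)} = ⊤
  · left
    have := hm.isSimpleModule_of_eq_top ht
    let e := LinearEquiv.ofBijective j (LinearMap.bijective_of_ne_zero hj0)
    refine ⟨e.symm.toLinearMap ∘ₗ C.mkQ, LinearMap.ext fun y => ?_⟩
    simp only [LinearMap.comp_apply, Submodule.subtype_apply]
    rw [← hj y]
    exact (e.symm_apply_apply (f y)).symm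
  · right
    have := h _ _ hm ht
    obtain ⟨s, hs⟩ := Module.projective_lifting_property C.mkQ LinearMap.id C.mkQ_surjective
    have hs' : ∀ y, C.mkQ (s y) = y := fun y => LinearMap.congr_fun hs y
    refine ⟨s ∘ₗ C.mkQ, ?_, ?_, LinearMap.codRestrict _ (s ∘ₗ j) ?_, ?_⟩
    · exact LinearMap.ext fun y => by
        simp only [Module.End.mul_apply, LinearMap.comp_apply, hs']
    · intro h0
      have h1 := hs' (C.mkQ x)
      rw [← LinearMap.comp_apply s, h0, LinearMap.zero_apply, map_zero] at h1
      exact hxC (by simpa using h1.symm)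
    · intro y
      obtain ⟨z, hz⟩ := C.mkQ_surjective (j y)
      exact ⟨z, by simp [← hz]⟩
    · refine LinearMap.ext fun y => Subtype.ext ?_
      simp only [LinearMap.comp_apply, LinearMap.codRestrict_apply, hj]
      rfl

theorem monolithicProjective_iff_isVModule_or_exists_summand :
    MonolithicProjective A ↔ ∀ (M : Type u) [AddCommGroup M] [Module A M],
      IsVModule A M ∨ ∃ P : Submodule A M, P ≠ ⊥ ∧ (∃ Q : Submodule A M, IsCompl P Q) ∧
        Module.Projective A P := by
  constructor
  · intro h M _ _
    rw [or_iff_not_imp_left, isVModule_iff]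
    intro hM
    push Not at hM
    obtain ⟨K, x, hx, hK⟩ := hM
    obtain ⟨C, hKC, hxC, hC | ⟨S, hS, hSt⟩⟩ := exists_isCoatom_or_isMonolith K hx
    · exact absurd (hK C hC hKC) hxC
    · have := h _ S hS hSt
      obtain ⟨D, hD⟩ := exists_isCompl_of_projective_quotient C
      refine ⟨D, ?_, ⟨C, hD⟩, Module.Projective.of_equiv (C.quotientEquivOfIsCompl D hD.symm)⟩
      rintro rfl
      have : C = ⊤ := by simpa using hD.sup_eq_top
      exact hxC (this ▸ trivial)
  · intro h U _ _ S hS hSt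
    obtain hV | ⟨P, hP, ⟨Q, hPQ⟩, _⟩ := h U
    · exact absurd hV (hS.not_isVModule hSt)
    · exact hS.projective_of_summand hP hPQ

end AlmostInjective

/-! ### Injective extensions preserving a monolith -/

section InjectiveHull

variable {A M : Type u} [Ring A] [AddCommGroup M] [Module A M]

theorem exists_injective_embedding (A M : Type u) [Ring A] [AddCommGroup M] [Module A M] :
    ∃ (Q : Type u) (_ : AddCommGroup Q) (_ : Module A Q) (i : M →ₗ[A] Q),
      Module.Injective A Q ∧ Function.Injective i := by
  let p := (CategoryTheory.EnoughInjectives.presentation (ModuleCat.of A M)).some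
  have h : CategoryTheory.Injective (ModuleCat.of A p.J) := p.injective
  exact ⟨p.J, inferInstance, inferInstance, p.f.hom,
    Module.injective_module_of_injective_object A p.J, (ModuleCat.mono_iff_injective p.f).1 p.mono⟩

theorem Module.Injective.of_retract {N : Type u} [AddCommGroup N] [Module A N]
    [Module.Injective A M] (i : N →ₗ[A] M) (r : M →ₗ[A] N) (h : ∀ x, r (i x) = x) :
    Module.Injective A N where
  out X Y _ _ _ _ f hf g := by
    obtain ⟨k, hk⟩ := Module.Injective.out f hf (i ∘ₗ g)
    exact ⟨r ∘ₗ k, fun x => by simp [hk, h]⟩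

theorem Module.Injective.of_linearEquiv {N : Type u} [AddCommGroup N] [Module A N]
    [Module.Injective A M] (e : M ≃ₗ[A] N) : Module.Injective A N :=
  .of_retract e.symm.toLinearMap e.toLinearMap (by simp)

theorem Submodule.map_ne_bot_of_injective {N : Type u} [AddCommGroup N] [Module A N]
    {f : M →ₗ[A] N} (hf : Function.Injective f) {K : Submodule A M} (hK : K ≠ ⊥) :
    K.map f ≠ ⊥ := fun h =>
  hK (Submodule.map_injective_of_injective hf (h.trans (Submodule.map_bot f).symm))

/-- An injective submodule disjoint from `Q` is the image of a projection killing `Q`. -/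
theorem exists_retraction_of_disjoint {P Q : Submodule A M} [Module.Injective A P]
    (h : Disjoint P Q) : ∃ q : M →ₗ[A] P, (∀ p : P, q p = p) ∧ ∀ x ∈ Q, q x = 0 := by
  obtain ⟨k, hk⟩ := Module.Injective.out (Q.mkQ ∘ₗ P.subtype) (by
    rw [← LinearMap.ker_eq_bot, LinearMap.ker_comp, Submodule.ker_mkQ,
      ← Submodule.disjoint_iff_comap_eq_bot]
    exact h) (LinearMap.id : P →ₗ[A] P)
  refine ⟨k ∘ₗ Q.mkQ, hk, fun x hx => ?_⟩
  simp [(Submodule.Quotient.mk_eq_zero Q).2 hx]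

/-- A module with a monolith embeds in an injective module with a monolith. -/
theorem IsMonolith.exists_injective_extension {S : Submodule A M} (hS : IsMonolith S) :
    ∃ (E : Type u) (_ : AddCommGroup E) (_ : Module A E) (i : M →ₗ[A] E) (T : Submodule A E),
      Module.Injective A E ∧ Function.Injective i ∧ IsMonolith T := by
  obtain ⟨Q, _, _, i, hQ, hi⟩ := exists_injective_embedding A M
  obtain ⟨x, hxS, hx0⟩ := Submodule.exists_mem_ne_zero_of_ne_bot hS.1
  have hix0 : i x ≠ 0 := fun h => hx0 (hi (h.trans (map_zero i).symm))
  -- `E` plays the role of an injective hull: it is maximal among the submodules whose nonzero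
  -- submodules all contain `i x`.
  obtain ⟨E, hiE, hE⟩ := zorn_le_nonempty₀
    {E : Submodule A Q | ∀ N ≤ E, N ≠ ⊥ → i x ∈ N} (by
      intro c hc hchain y hy
      refine ⟨sSup c, fun N hN hN0 => ?_, fun z hz => le_sSup hz⟩
      obtain ⟨z, hz, hz0⟩ := Submodule.exists_mem_ne_zero_of_ne_bot hN0
      obtain ⟨D, hD, hzD⟩ :=
        (Submodule.mem_sSup_of_directed ⟨y, hy⟩ hchain.directedOn).1 (hN hz)
      have h1 := hc hD (Submodule.span A {z}) (by simpa using hzD)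
        (by rwa [Ne, Submodule.span_singleton_eq_bot])
      exact (Submodule.span_singleton_le_iff_mem _ _).2 hz h1)
    (LinearMap.range i) (by
      intro N hN hN0
      refine hS.2 (N.comap i) (fun h => hN0 ?_) hxS
      rw [← inf_eq_right.2 hN, ← Submodule.map_comap_eq, h, Submodule.map_bot])
  have hxE : i x ∈ E := hiE ⟨x, rfl⟩
  obtain ⟨C, -, hxC, hC⟩ := exists_maximal_notMem (⊥ : Submodule A Q) (x := i x) (by simpa)
  have hdisj : Disjoint E C := by
    rw [disjoint_iff]
    by_contra h
    exact hxC (hE.prop _ inf_le_left h).2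
  obtain ⟨φ, hφ⟩ := Module.Injective.out (C.mkQ ∘ₗ E.subtype) (by
    rw [← LinearMap.ker_eq_bot, LinearMap.ker_comp, Submodule.ker_mkQ,
      ← Submodule.disjoint_iff_comap_eq_bot]
    exact hdisj) E.subtype
  have hm := isMonolith_quotient hxC hC
  have hφx : φ (C.mkQ (i x)) = i x := hφ ⟨i x, hxE⟩
  -- The range of `φ` contains `E` and inherits the defining property of `E` from the monolith of `Q
  -- ⧸ C`. By maximality it is `E`, so `φ ∘ C.mkQ` retracts `Q` onto `E`.
  have hrange : LinearMap.range φ ≤ E := by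
    refine hE.le_of_ge (fun N hN hN0 => ?_) fun y hy => ⟨_, hφ ⟨y, hy⟩⟩
    have h1 : N.comap φ ≠ ⊥ := fun h => hN0 (by
      rw [← inf_eq_right.2 hN, ← Submodule.map_comap_eq, h, Submodule.map_bot])
    have h2 := hm.2 _ h1 (Submodule.mem_span_singleton_self _)
    rwa [Submodule.mem_comap, hφx] at h2
  refine ⟨E, inferInstance, inferInstance, i.codRestrict E fun y => hiE ⟨y, rfl⟩,
    Submodule.span A {⟨i x, hxE⟩}, ?_, ?_, ?_, ?_⟩
  · exact .of_retract E.subtype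
      (LinearMap.codRestrict E (φ ∘ₗ C.mkQ) fun y => hrange ⟨_, rfl⟩)
      fun y => Subtype.ext (hφ y)
  · exact fun a b hab => hi (congrArg Subtype.val hab)
  · rw [Ne, Submodule.span_singleton_eq_bot]
    exact fun h => hix0 (congrArg Subtype.val h)
  · intro N hN
    rw [Submodule.span_singleton_le_iff_mem]
    obtain ⟨y, hy, hyx⟩ := hE.prop (N.map E.subtype) (Submodule.map_subtype_le E N)
      (Submodule.map_ne_bot_of_injective E.injective_subtype hN)
    rwa [← show y = ⟨i x, hxE⟩ from Subtype.ext hyx]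

end InjectiveHull

/-! ### Modules with a proper monolith are injective of length two -/

section Structure

variable {A M : Type u} [Ring A] [AddCommGroup M] [Module A M]

theorem IsMonolith.isCoatom_of_injective (h : MonolithicProjective A) {S : Submodule A M}
    (hS : IsMonolith S) (hSt : S ≠ ⊤) [Module.Injective A M] : IsCoatom S := by
  have hproj := h M S hS hSt
  -- In the non-maximal case `C` would be a summand containing `S`, hence everything by uniformity.
  have hmax : ∀ y ∉ S, ∃ C : Submodule A M, IsCoatom C ∧ S ≤ C ∧ y ∉ C := by
    intro y hy
    obtain ⟨C, hSC, hyC, hC | ⟨T, hT, hTt⟩⟩ := exists_isCoatom_or_isMonolith S hy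
    · exact ⟨C, hC, hSC, hyC⟩
    · have := h _ T hT hTt
      obtain ⟨D, hD⟩ := exists_isCompl_of_projective_quotient C
      have hD0 : D = ⊥ := hS.eq_bot_of_disjoint hD.disjoint.symm
        fun h0 => hS.1 (le_bot_iff.1 (h0 ▸ hSC))
      have hCt : C = ⊤ := by simpa [hD0] using hD.sup_eq_top
      exact absurd (hCt ▸ trivial) hyC
  -- The image of an injective endomorphism is a nonzero summand of the uniform module `M`.
  have hinj : ∀ a : M →ₗ[A] M, Function.Injective a → LinearMap.range a = ⊤ := by
    intro a ha
    obtain ⟨r, hr⟩ := Module.Injective.out a ha LinearMap.id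
    have hker : LinearMap.ker r = ⊥ := by
      refine hS.eq_bot_of_disjoint (P := LinearMap.range a) ?_ ?_
      · rw [Submodule.disjoint_def]
        rintro _ ⟨y, rfl⟩ hy
        rw [LinearMap.mem_ker, hr] at hy
        rw [show y = 0 from hy, map_zero]
      · rw [Ne, LinearMap.range_eq_bot]
        rintro rfl
        obtain ⟨x, -, hx0⟩ := Submodule.exists_mem_ne_zero_of_ne_bot hS.1
        exact hx0 (ha rfl)
    refine LinearMap.range_eq_top.2 fun y => ⟨r y, LinearMap.ker_eq_bot.1 hker ?_⟩
    rw [hr]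
    rfl
  -- Projectivity of `M = L₁ + L₂` writes the identity as `a + b` with images in `L₁` and `L₂`. The
  -- kernels of `a` and `b` are disjoint, so one map is injective, hence onto, and that `Lᵢ` is not
  -- proper.
  have huniq : ∀ L₁ L₂ : Submodule A M, IsCoatom L₁ → IsCoatom L₂ → L₁ = L₂ := by
    intro L₁ L₂ h₁ h₂
    by_contra hne
    have hsup : L₁ ⊔ L₂ = ⊤ := (h₁.codisjoint_of_ne h₂ hne).eq_top
    obtain ⟨s, hs⟩ := Module.projective_lifting_property (L₁.subtype.coprod L₂.subtype)
      LinearMap.id (LinearMap.range_eq_top.1 (by simpa [LinearMap.range_coprod] using hsup))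
    have hs' : ∀ y, ((s y).1 : M) + (s y).2 = y := fun y => LinearMap.congr_fun hs y
    let a : M →ₗ[A] M := L₁.subtype ∘ₗ LinearMap.fst A L₁ L₂ ∘ₗ s
    let b : M →ₗ[A] M := L₂.subtype ∘ₗ LinearMap.snd A L₁ L₂ ∘ₗ s
    have hab : Disjoint (LinearMap.ker a) (LinearMap.ker b) := by
      rw [Submodule.disjoint_def]
      intro y hy1 hy2
      rw [← hs' y, show ((s y).1 : M) = 0 from hy1, show ((s y).2 : M) = 0 from hy2, add_zero]
    by_cases ha : LinearMap.ker a = ⊥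
    · refine h₁.1 (top_le_iff.1 (hinj a (LinearMap.ker_eq_bot.1 ha) ▸ ?_))
      rintro _ ⟨y, rfl⟩
      exact (s y).1.2
    · have hb := hS.eq_bot_of_disjoint hab ha
      refine h₂.1 (top_le_iff.1 (hinj b (LinearMap.ker_eq_bot.1 hb) ▸ ?_))
      rintro _ ⟨y, rfl⟩
      exact (s y).2.2
  obtain ⟨y, hy⟩ : ∃ y, y ∉ S := by
    by_contra! hall
    exact hSt (eq_top_iff.2 fun y _ => hall y)
  obtain ⟨C, hC, hSC, -⟩ := hmax y hy
  have hCS : C = S := by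
    refine le_antisymm (fun z hz => ?_) hSC
    by_contra hzS
    obtain ⟨C', hC', -, hzC'⟩ := hmax z hzS
    exact hzC' (huniq C C' hC hC' ▸ hz)
  exact hCS ▸ hC

theorem MonolithicProjective.injective_and_isCoatom (h : MonolithicProjective A)
    {S : Submodule A M} (hS : IsMonolith S) (hSt : S ≠ ⊤) :
    Module.Injective A M ∧ IsCoatom S := by
  obtain ⟨E, _, _, i, T, hE, hi, hT⟩ := hS.exists_injective_extension
  have hr : LinearMap.range i ≠ ⊥ := by
    rw [Ne, LinearMap.range_eq_bot]
    rintro rfl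
    obtain ⟨x, -, hx0⟩ := Submodule.exists_mem_ne_zero_of_ne_bot hS.1
    exact hx0 (hi rfl)
  -- In the injective extension `E` the monolith `T` is maximal, and `i(M)` lies strictly above it,
  -- so `i` is onto.
  have hTr : T ≤ LinearMap.range i := hT.2 _ hr
  have hTi : T < LinearMap.range i := by
    refine lt_of_le_of_ne hTr fun hEq => hSt ?_
    have hmap : S.map i = T := by
      refine (hT.isAtom.le_iff.1 (hEq ▸ LinearMap.map_le_range)).resolve_left ?_
      exact Submodule.map_ne_bot_of_injective hi hS.1
    rw [eq_top_iff, ← Submodule.map_le_map_iff_of_injective hi, hmap, Submodule.map_top, hEq]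
  have hTc := hT.isCoatom_of_injective h (fun h0 => not_top_lt (h0 ▸ hTi))
  let e := LinearEquiv.ofBijective i ⟨hi, LinearMap.range_eq_top.1 (hTc.2 _ hTi)⟩
  have hM := Module.Injective.of_linearEquiv e.symm
  exact ⟨hM, hS.isCoatom_of_injective h hSt⟩

end Structure

/-! ### Essentiality and independence in modular lattices -/

section Independence

variable {α : Type*} [CompleteLattice α] [IsModularLattice α]

/-- The terms `j i` are enlarged to `p i` one at a time. The statement is for all `d` because the
induction hypothesis is applied to `d ⊔ j k`. -/
theorem Disjoint.finset_sup_of_essential {ι : Type*} {p j : ι → α} (hj : iSupIndep j)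
    (hess : ∀ i b, Disjoint (j i) b → Disjoint (p i) b) (s : Finset ι) :
    ∀ d : α, Disjoint d (s.sup j) → Disjoint d (s.sup p) := by
  classical
  induction s using Finset.induction_on with
  | empty => simp
  | insert k s hk ih =>
    intro d hd
    rw [Finset.sup_insert] at hd ⊢
    have hkj : Disjoint (j k) (s.sup j) := by
      refine (hj k).mono_right (Finset.sup_le fun i hi => ?_)
      exact le_iSup₂_of_le i (by rintro rfl; exact hk hi) le_rfl
    have h1 := ih _ (Disjoint.disjoint_sup_left_of_disjoint_sup_right hkj hd)
    have h2 : Disjoint (j k) (d ⊔ s.sup p) :=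
      Disjoint.disjoint_sup_right_of_disjoint_sup_left
        (hd.mono_right le_sup_left).symm (by rwa [sup_comm (j k) d])
    have h3 := hess k _ h2
    have h4 : Disjoint d (s.sup p) := h1.mono_left le_sup_left
    rw [sup_comm (p k)]
    exact Disjoint.disjoint_sup_right_of_disjoint_sup_left h4 h3.symm

/-- An element disjoint from a sum of elements which are essential in larger elements is disjoint
from the sum of the larger elements. -/
theorem Disjoint.iSup_of_essential [IsCompactlyGenerated α] {ι : Type*} {p j : ι → α}
    (hj : iSupIndep j) (hess : ∀ i b, Disjoint (j i) b → Disjoint (p i) b) {d : α}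
    (hd : Disjoint d (⨆ i, j i)) : Disjoint d (⨆ i, p i) := by
  classical
  rw [iSup_eq_iSup_finset]
  have hdir : Directed (· ≤ ·) fun s : Finset ι => ⨆ i ∈ s, p i := by
    refine Monotone.directed_le fun s t hst => ?_
    exact biSup_mono fun i hi => hst hi
  rw [hdir.disjoint_iSup_right]
  intro s
  rw [← Finset.sup_eq_iSup]
  refine Disjoint.finset_sup_of_essential hj hess s d (hd.mono_right ?_)
  exact Finset.sup_le fun i _ => le_iSup j i

theorem sSupIndep.insert_of_disjoint {s : Set α} (hs : sSupIndep s) {d : α}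
    (hd : Disjoint d (sSup s)) : sSupIndep (insert d s) := by
  intro x hx
  by_cases hxd : x = d
  · subst hxd
    exact hd.mono_right (sSup_le_sSup fun y hy => hy.1.resolve_left hy.2)
  · have hxs : x ∈ s := hx.resolve_left hxd
    refine (Disjoint.disjoint_sup_right_of_disjoint_sup_left (hs hxs)
      (c := d) ?_).mono_right (sSup_le ?_)
    · exact (hd.mono_right (sup_le (le_sSup hxs) (sSup_le_sSup Set.sdiff_subset))).symm
    · rintro y ⟨rfl | hy, hyx⟩
      · exact le_sup_right
      · exact (le_sSup (show y ∈ s \ {x} from ⟨hy, hyx⟩)).trans le_sup_left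

end Independence

/-! ### The radical as a sum of monoliths -/

section Radical

variable {A M : Type u} [Ring A] [AddCommGroup M] [Module A M]

theorem IsMonolith.jacobson_eq {S : Submodule A M} (hS : IsMonolith S) (hS' : IsCoatom S) :
    Module.jacobson A M = S := by
  refine le_antisymm (sInf_le hS') (le_sInf fun C hC => hS.2 C ?_)
  rintro rfl
  exact hS'.1 (hC.2 S hS.1.bot_lt)

theorem IsMonolith.length_eq_two {S : Submodule A M} (hS : IsMonolith S) (hS' : IsCoatom S) :
    Module.length A M = 2 := by
  have := hS.isSimpleModule
  have := isSimpleModule_iff_isCoatom.2 hS'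
  rw [Module.length_eq_add_of_exact S.subtype S.mkQ S.injective_subtype S.mkQ_surjective
    (LinearMap.exact_subtype_mkQ S), Module.length_eq_one, Module.length_eq_one]
  norm_num

theorem IsMonolith.isLocalModule {S : Submodule A M} (hS : IsMonolith S) (hS' : IsCoatom S) :
    IsLocalModule A M := by
  refine ⟨S, hS'.1, fun K hK => ?_⟩
  by_cases h : K = ⊥
  · exact h ▸ bot_le
  · rcases (hS.2 K h).eq_or_lt with h | h
    · exact h.ge
    · exact absurd (hS'.2 K h) hK

theorem IsLocalModule.exists_isMonolith (h : IsLocalModule A M) (hl : Module.length A M = 2) :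
    ∃ S : Submodule A M, IsMonolith S ∧ IsCoatom S := by
  obtain ⟨S, hSt, hS⟩ := h
  have hc : IsCoatom S := ⟨hSt, fun K hK => by
    by_contra hKt
    exact hK.not_ge (hS K hKt)⟩
  have := isSimpleModule_iff_isCoatom.2 hc
  rw [Module.length_eq_add_of_exact S.subtype S.mkQ S.injective_subtype S.mkQ_surjective
    (LinearMap.exact_subtype_mkQ S), Module.length_eq_one A (M ⧸ S)] at hl
  have hl1 : Module.length A S = 1 := by
    rw [← one_add_one_eq_two] at hl
    exact ENat.add_left_injective_of_ne_top ENat.one_ne_top hl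
  have hat := isSimpleModule_iff_isAtom.1 (Module.length_eq_one_iff.1 hl1)
  refine ⟨S, ⟨hat.1, fun K hK => ?_⟩, hc⟩
  by_cases hKt : K = ⊤
  · exact hKt ▸ le_top
  · exact ((hat.le_iff.1 (hS K hKt)).resolve_left hK).ge

theorem radicalOf_le (P : Submodule A M) : radicalOf P ≤ P :=
  Submodule.map_subtype_le P _

theorem radicalOf_le_jacobson (P : Submodule A M) : radicalOf P ≤ Module.jacobson A M :=
  Module.map_jacobson_le P.subtype

theorem radicalOf_ne_bot {P : Submodule A M} {S : Submodule A P} (hS : IsMonolith S)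
    (hS' : IsCoatom S) : radicalOf P ≠ ⊥ := by
  unfold radicalOf
  rw [hS.jacobson_eq hS']
  exact Submodule.map_ne_bot_of_injective P.injective_subtype hS.1

/-- The radical of `P` is its monolith, hence essential in `P`. -/
theorem disjoint_of_disjoint_radicalOf {P : Submodule A M} {S : Submodule A P} (hS : IsMonolith S)
    (hS' : IsCoatom S) {B : Submodule A M} (h : Disjoint (radicalOf P) B) : Disjoint P B := by
  rw [Submodule.disjoint_iff_comap_eq_bot]
  by_contra hne
  refine radicalOf_ne_bot hS hS' (h.eq_bot_of_le ?_)
  unfold radicalOf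
  rw [hS.jacobson_eq hS', Submodule.map_le_iff_le_comap]
  exact hS.2 _ hne

/-- There is a maximal independent family of injective submodules of `M` having a monolith that is
also a maximal submodule. -/
theorem exists_maximal_sSupIndep_injective (A M : Type u) [Ring A] [AddCommGroup M] [Module A M] :
    ∃ s : Set (Submodule A M), sSupIndep s ∧
      (∀ P ∈ s, Module.Injective A P ∧ ∃ S : Submodule A P, IsMonolith S ∧ IsCoatom S) ∧
      ∀ P : Submodule A M, Module.Injective A P →
        (∃ S : Submodule A P, IsMonolith S ∧ IsCoatom S) → ¬ Disjoint P (sSup s) := by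
  obtain ⟨s, hs⟩ := zorn_subset {s : Set (Submodule A M) | sSupIndep s ∧
      ∀ P ∈ s, Module.Injective A P ∧ ∃ S : Submodule A P, IsMonolith S ∧ IsCoatom S} (by
    intro c hc hchain
    refine ⟨⋃₀ c, ⟨iSupIndep_sUnion_of_directed hchain.directedOn fun a ha => (hc ha).1, ?_⟩,
      fun t ht => Set.subset_sUnion_of_mem ht⟩
    rintro P ⟨t, ht, hPt⟩
    exact (hc ht).2 P hPt)
  refine ⟨s, hs.prop.1, hs.prop.2, fun P hP hPS hdisj => ?_⟩
  have hins := hs.le_of_ge (y := insert P s)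
    ⟨hs.prop.1.insert_of_disjoint hdisj, by
      rintro Q (rfl | hQ)
      · exact ⟨hP, hPS⟩
      · exact hs.prop.2 Q hQ⟩ (Set.subset_insert P s) (Set.mem_insert P s)
  obtain ⟨S, hS, -⟩ := hPS
  have hP0 : P = ⊥ := hdisj.eq_bot_of_le (le_sSup hins)
  subst hP0
  exact hS.1 (Subsingleton.elim _ _)

theorem MonolithicProjective.exists_isCompl (h : MonolithicProjective A) {C : Submodule A M}
    {S : Submodule A (M ⧸ C)} (hS : IsMonolith S) (hSt : S ≠ ⊤) :
    ∃ D : Submodule A M, IsCompl D C ∧ Module.Injective A D ∧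
      ∃ T : Submodule A D, IsMonolith T ∧ IsCoatom T := by
  have := h _ S hS hSt
  obtain ⟨D, hD⟩ := exists_isCompl_of_projective_quotient C
  let e : (M ⧸ C) ≃ₗ[A] D := C.quotientEquivOfIsCompl D hD.symm
  obtain ⟨hinj, -⟩ := h.injective_and_isCoatom hS hSt
  have hT := hS.map_equiv e
  refine ⟨D, hD, .of_linearEquiv e, _, hT, (h.injective_and_isCoatom hT fun htop => hSt ?_).2⟩
  rw [eq_top_iff, ← Submodule.map_le_map_iff_of_injective e.injective]
  exact le_top.trans htop.ge

theorem MonolithicProjective.jacobson_eq_iSup (h : MonolithicProjective A)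
    {s : Set (Submodule A M)} (hs : sSupIndep s)
    (hs' : ∀ P ∈ s, ∃ S : Submodule A P, IsMonolith S ∧ IsCoatom S)
    (hmax : ∀ P : Submodule A M, Module.Injective A P →
        (∃ S : Submodule A P, IsMonolith S ∧ IsCoatom S) → ¬ Disjoint P (sSup s)) :
    Module.jacobson A M = ⨆ P : s, radicalOf (P : Submodule A M) := by
  refine le_antisymm (fun x hx => ?_) (iSup_le fun P => radicalOf_le_jacobson _)
  by_contra hxJ
  obtain ⟨C, hJC, hxC, hC | ⟨S, hS, hSt⟩⟩ := exists_isCoatom_or_isMonolith _ hxJ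
  · exact hxC (Submodule.mem_sInf.1 hx C hC)
  -- The complement `D` of `C` misses all the radicals, hence by essentiality the whole sum of the
  -- family, against maximality.
  · obtain ⟨D, hD, hDinj, hDS⟩ := h.exists_isCompl hS hSt
    refine hmax D hDinj hDS ?_
    rw [sSup_eq_iSup']
    refine Disjoint.iSup_of_essential (j := fun P : s => radicalOf (P : Submodule A M)) ?_ ?_
      (hD.disjoint.mono_right hJC)
    · exact ((sSupIndep_iff s).1 hs).mono fun P => radicalOf_le _
    · intro P B hB
      obtain ⟨T, hT, hT'⟩ := hs' P P.2
      exact disjoint_of_disjoint_radicalOf hT hT' hB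

/-- Above the radical every submodule is an intersection of maximal submodules. -/
theorem MonolithicProjective.exists_isCoatom (h : MonolithicProjective A) {K : Submodule A M}
    (hK : Module.jacobson A M ≤ K) {x : M} (hx : x ∉ K) :
    ∃ C, IsCoatom C ∧ K ≤ C ∧ x ∉ C := by
  obtain ⟨C, hKC, hxC, hC | ⟨S, hS, hSt⟩⟩ := exists_isCoatom_or_isMonolith K hx
  · exact ⟨C, hC, hKC, hxC⟩
  -- The nonzero radical of the complement `D` would lie in `J(M) ≤ C`.
  · obtain ⟨D, hD, -, T, hT, hT'⟩ := h.exists_isCompl hS hSt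
    exact absurd (le_bot_iff.1 (hD.disjoint (radicalOf_le D)
      ((radicalOf_le_jacobson D).trans (hK.trans hKC)))) (radicalOf_ne_bot hT hT')

end Radical

/-! ### Left-right symmetry of the Jacobson radical -/

section JacobsonOpposite

variable {R : Type u} [Ring R]

theorem Ring.isUnit_one_sub_of_mem_jacobson {x : R} (hx : x ∈ Ring.jacobson R) :
    IsUnit (1 - x) := by
  have key : ∀ y ∈ Ring.jacobson R, ∃ a, a * (1 - y) = 1 := by
    intro y hy
    rw [← Ideal.mem_span_singleton', ← Ideal.eq_top_iff_one]
    by_contra h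
    obtain ⟨m, hm, hle⟩ := Ideal.exists_le_maximal _ h
    refine hm.ne_top ((Ideal.eq_top_iff_one m).2 ?_)
    have h1 : 1 - y ∈ m := hle (Ideal.mem_span_singleton_self _)
    have h2 : y ∈ m := Ring.jacobson_le_of_isMaximal m hy
    simpa using m.add_mem h1 h2
  obtain ⟨a, ha⟩ := key x hx
  -- A left inverse `a` of `1 - x` equals `1 + a * x`, so it has a left inverse too.
  obtain ⟨b, hb⟩ := key (-(a * x)) (neg_mem (Ideal.mul_mem_left _ a hx))
  have hba : b * a = 1 := by
    have : 1 - -(a * x) = a := by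
      rw [← ha]
      noncomm_ring
    rwa [this] at hb
  exact ⟨⟨1 - x, a, by rwa [← left_inv_eq_right_inv hba ha], ha⟩, rfl⟩

theorem Ring.mem_jacobson_iff_isUnit {x : R} :
    x ∈ Ring.jacobson R ↔ ∀ r : R, IsUnit (1 - r * x) := by
  refine ⟨fun hx r => isUnit_one_sub_of_mem_jacobson (Ideal.mul_mem_left _ r hx), fun h => ?_⟩
  rw [Ring.jacobson_eq_sInf_isMaximal, Submodule.mem_sInf]
  intro m hm
  by_contra hxm
  obtain ⟨r, hr⟩ := hm.exists_inv hxm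
  obtain ⟨y, hy, hyr⟩ := hr
  exact hm.ne_top (Ideal.eq_top_of_isUnit_mem _ hy (by
    rw [eq_sub_of_add_eq' hyr]
    exact h r))

theorem isUnit_one_sub_mul_swap {x r : R} (h : IsUnit (1 - r * x)) : IsUnit (1 - x * r) := by
  obtain ⟨⟨u, v, huv, hvu⟩, rfl : u = 1 - r * x⟩ := h
  -- The inverse comes from the formal geometric series, with `v` the inverse of `1 - r * x`.
  refine ⟨⟨1 - x * r, 1 + x * v * r, ?_, ?_⟩, rfl⟩
  · calc (1 - x * r) * (1 + x * v * r) = 1 - x * r + x * ((1 - r * x) * v) * r := by noncomm_ring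
      _ = 1 := by rw [huv]; noncomm_ring
  · calc (1 + x * v * r) * (1 - x * r) = 1 - x * r + x * (v * (1 - r * x)) * r := by noncomm_ring
      _ = 1 := by rw [hvu]; noncomm_ring

/-- The right and the left Jacobson radical of a ring coincide. -/
theorem mem_jacobson_mulOpposite_iff {x : R} :
    x ∈ Module.jacobson Rᵐᵒᵖ R ↔ x ∈ Ring.jacobson R := by
  let f : R →ₗ[Rᵐᵒᵖ] Rᵐᵒᵖ :=
    { toFun := MulOpposite.op
      map_add' := fun _ _ => rfl
      map_smul' := fun _ _ => rfl }
  have hf : Function.Bijective f := MulOpposite.op_bijective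
  rw [← Module.comap_jacobson_of_bijective hf, Submodule.mem_comap, Ring.mem_jacobson_iff_isUnit,
    Ring.mem_jacobson_iff_isUnit]
  have hu : ∀ r : R, IsUnit (1 - MulOpposite.op r * f x) ↔ IsUnit (1 - x * r) := fun r =>
    isUnit_op (m := 1 - x * r)
  constructor
  · exact fun h r => isUnit_one_sub_mul_swap ((hu r).1 (h _))
  · exact fun h r => (hu r.unop).2 (isUnit_one_sub_mul_swap (h _))

end JacobsonOpposite

/-! ### The V-ring condition modulo the radical -/

section QuotientRing

/-- Semilinearity lets the scalars change along with the module, as in passing from `R` to `R/J(R)`.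
-/
theorem isVModule_iff_of_surjective {A B M N : Type u} [Ring A] [Ring B] [AddCommGroup M]
    [Module A M] [AddCommGroup N] [Module B N] {τ : A →+* B} [RingHomSurjective τ]
    {f : M →ₛₗ[τ] N} (hf : Function.Surjective f) :
    IsVModule B N ↔ ∀ K : Submodule A M, LinearMap.ker f ≤ K → ∀ x ∉ K,
      ∃ C, IsCoatom C ∧ K ≤ C ∧ x ∉ C := by
  rw [isVModule_iff]
  constructor
  · intro h K hK x hx
    obtain ⟨C, hC, hKC, hxC⟩ := h (K.map f) (f x) (by
      rwa [← Submodule.mem_comap, Submodule.comap_map_eq_self hK])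
    exact ⟨C.comap f, (Submodule.isCoatom_comap_iff hf).2 hC,
      Submodule.map_le_iff_le_comap.1 hKC, hxC⟩
  · intro h K y hy
    obtain ⟨x, rfl⟩ := hf y
    obtain ⟨C, hC, hKC, hxC⟩ := h (K.comap f) (LinearMap.ker_le_comap f) x hy
    have hker : LinearMap.ker f ≤ C := (LinearMap.ker_le_comap f).trans hKC
    refine ⟨C.map f, Submodule.isCoatom_map_of_ker_le hf hker hC, ?_, ?_⟩
    · rw [← Submodule.map_comap_eq_of_surjective hf K]
      exact Submodule.map_mono hKC
    · rwa [← Submodule.mem_comap, Submodule.comap_map_eq_self hker]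

theorem isRightVRing_quotient_jacobson_iff {R : Type u} [Ring R] :
    IsRightVRing (R ⧸ Ring.jacobson R) ↔ ∀ K : Submodule Rᵐᵒᵖ R, Module.jacobson Rᵐᵒᵖ R ≤ K →
      ∀ x ∉ K, ∃ C, IsCoatom C ∧ K ≤ C ∧ x ∉ C := by
  let τ : Rᵐᵒᵖ →+* (R ⧸ Ring.jacobson R)ᵐᵒᵖ := (Ideal.Quotient.mk (Ring.jacobson R)).op
  have : RingHomSurjective τ := ⟨fun y => by
    obtain ⟨x, hx⟩ := Ideal.Quotient.mk_surjective y.unop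
    exact ⟨MulOpposite.op x, congrArg MulOpposite.op hx⟩⟩
  let f : R →ₛₗ[τ] R ⧸ Ring.jacobson R :=
    { toFun := Ideal.Quotient.mk (Ring.jacobson R)
      map_add' := fun _ _ => rfl
      map_smul' := fun _ _ => rfl }
  have hker : LinearMap.ker f = Module.jacobson Rᵐᵒᵖ R := by
    ext x
    rw [mem_jacobson_mulOpposite_iff]
    exact Ideal.Quotient.eq_zero_iff_mem
  rw [← hker]
  exact isVModule_iff_of_surjective (f := f) Ideal.Quotient.mk_surjective

end QuotientRing

/-! ### Idempotents and local injective right ideals -/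

section RightIdeals

variable {R : Type u} [Ring R]

/-- Each `P` in the maximal family is injective, so some projection `q P` onto it kills the other
members. This map is left multiplication by `e P = q P 1`, which makes the `e P` orthogonal
idempotents. -/
theorem MonolithicProjective.exists_orthogonalIdempotents (h : MonolithicProjective Rᵐᵒᵖ) :
    ∃ (I : Type u) (e : I → R), OrthogonalIdempotents e ∧
      (∀ i, IsLocalModule Rᵐᵒᵖ (principalRightIdeal (e i)) ∧
        Module.Injective Rᵐᵒᵖ (principalRightIdeal (e i)) ∧
        Module.length Rᵐᵒᵖ (principalRightIdeal (e i)) = 2) ∧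
      (iSupIndep (fun i => radicalOf (principalRightIdeal (e i))) ∧
        Module.jacobson Rᵐᵒᵖ R = ⨆ i, radicalOf (principalRightIdeal (e i))) ∧
      IsRightVRing (R ⧸ Ring.jacobson R) := by
  obtain ⟨s, hs, hs', hmax⟩ := exists_maximal_sSupIndep_injective Rᵐᵒᵖ R
  have hq : ∀ P : s, ∃ q : R →ₗ[Rᵐᵒᵖ] (P : Submodule Rᵐᵒᵖ R),
      (∀ p : (P : Submodule Rᵐᵒᵖ R), q p = p) ∧ ∀ x ∈ sSup (s \ {↑P}), q x = 0 := fun P => by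
    have := (hs' P P.2).1
    exact exists_retraction_of_disjoint (hs P.2)
  choose q hqid hq0 using hq
  let e : s → R := fun P => q P 1
  have he : ∀ P r, e P * r = q P r := fun P r => by
    have := (q P).map_smul (MulOpposite.op r) 1
    rw [op_smul_eq_mul, one_mul] at this
    rw [this]
    rfl
  have heP : ∀ P, principalRightIdeal (e P) = P := fun P => by
    ext x
    rw [mem_principalRightIdeal]
    constructor
    · rintro ⟨r, rfl⟩
      rw [he]
      exact (q P r).2
    · intro hx
      exact ⟨x, by rw [he]; exact (congrArg Subtype.val (hqid P ⟨x, hx⟩)).symm⟩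
  refine ⟨s, e, ⟨fun P => ?_, fun P P' hne => ?_⟩, fun P => ?_, ⟨?_, ?_⟩, ?_⟩
  · change e P * e P = e P
    rw [he]
    exact congrArg Subtype.val (hqid P (q P 1))
  · change e P * e P' = 0
    rw [he, hq0 P _ (le_sSup (show (P' : Submodule Rᵐᵒᵖ R) ∈ s \ {↑P} from
      ⟨P'.2, fun h => hne (Subtype.ext h.symm)⟩) (q P' 1).2)]
    rfl
  · rw [heP]
    obtain ⟨hinj, S, hS, hS'⟩ := hs' P P.2
    exact ⟨hS.isLocalModule hS', hinj, hS.length_eq_two hS'⟩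
  · simp_rw [heP]
    exact ((sSupIndep_iff s).1 hs).mono fun P => radicalOf_le _
  · simp_rw [heP]
    exact h.jacobson_eq_iSup hs (fun P hP => (hs' P hP).2) hmax
  · exact isRightVRing_quotient_jacobson_iff.2 fun K hK x hx => h.exists_isCoatom hK hx

theorem monolithicProjective_of_orthogonalIdempotents {I : Type u} {e : I → R}
    (he : OrthogonalIdempotents e)
    (hloc : ∀ i, IsLocalModule Rᵐᵒᵖ (principalRightIdeal (e i)))
    (hinj : ∀ i, Module.Injective Rᵐᵒᵖ (principalRightIdeal (e i)))
    (hlen : ∀ i, Module.length Rᵐᵒᵖ (principalRightIdeal (e i)) = 2)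
    (hJ : Module.jacobson Rᵐᵒᵖ R = ⨆ i, radicalOf (principalRightIdeal (e i)))
    (hV : IsRightVRing (R ⧸ Ring.jacobson R)) : MonolithicProjective Rᵐᵒᵖ := by
  intro U _ _ S hS hSt
  let f : U → R →ₗ[Rᵐᵒᵖ] U := fun u =>
    { toFun := fun r => MulOpposite.op r • u
      map_add' := fun a b => by rw [MulOpposite.op_add, add_smul]
      map_smul' := fun a b => by
        rw [RingHom.id_apply, ← mul_smul]
        rfl }
  by_cases hU : ∀ u, Module.jacobson Rᵐᵒᵖ R ≤ LinearMap.ker (f u)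
  · exfalso
    rw [isRightVRing_quotient_jacobson_iff] at hV
    obtain ⟨y, hy⟩ : ∃ y, y ∉ S := by
      by_contra! hall
      exact hSt (eq_top_iff.2 fun y _ => hall y)
    have hf1 : f y 1 = y := one_smul _ y
    have hrange : LinearMap.range (f y) ≠ ⊥ := fun h0 => hy (by
      have : y ∈ LinearMap.range (f y) := ⟨1, hf1⟩
      rw [h0, Submodule.mem_bot] at this
      rw [this]
      exact S.zero_mem)
    obtain ⟨x, hxS, hx0⟩ := Submodule.exists_mem_ne_zero_of_ne_bot hS.1
    obtain ⟨r, rfl⟩ := hS.2 _ hrange hxS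
    obtain ⟨C, hC, hKC, hrC⟩ := hV _ (hU y) r hx0
    -- If `yC` were nonzero, it would contain the monolith and so `y r`. Then `r ∈ C`, as `C`
    -- contains the annihilator of `y`. So `yC = 0`, and maximality of `C` puts `y` in `S`.
    have hmap : C.map (f y) = ⊥ := by
      by_contra hne
      obtain ⟨c, hc, hcr⟩ := hS.2 _ hne hxS
      refine hrC ?_
      have hmem : r - c ∈ C := hKC (by rw [LinearMap.mem_ker, map_sub, hcr, sub_self])
      simpa using C.add_mem hmem hc
    have hle : C < S.comap (f y) := by
      refine lt_of_le_of_ne (fun c hc => ?_) fun hEq => hrC (hEq ▸ hxS)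
      have : f y c ∈ C.map (f y) := Submodule.mem_map_of_mem hc
      rw [hmap, Submodule.mem_bot] at this
      rw [Submodule.mem_comap, this]
      exact S.zero_mem
    have h1 : (1 : R) ∈ S.comap (f y) := hC.2 _ hle ▸ trivial
    rw [Submodule.mem_comap, hf1] at h1
    exact hy h1
  · push Not at hU
    obtain ⟨u, hu⟩ := hU
    rw [hJ, iSup_le_iff, not_forall] at hu
    obtain ⟨i, hi⟩ := hu
    obtain ⟨T, hT, hT'⟩ := (hloc i).exists_isMonolith (hlen i)
    have := hinj i
    let g : principalRightIdeal (e i) →ₗ[Rᵐᵒᵖ] U := f u ∘ₗ (principalRightIdeal (e i)).subtype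
    -- A nonzero kernel would contain the monolith of `e i R`, which is its radical, but `u` does
    -- not annihilate that.
    have hg : Function.Injective g := by
      rw [← LinearMap.ker_eq_bot]
      by_contra hne
      refine hi ?_
      unfold radicalOf
      rw [hT.jacobson_eq hT', Submodule.map_le_iff_le_comap]
      exact hT.2 _ hne
    obtain ⟨k, hk⟩ := Module.Injective.out g hg LinearMap.id
    have hker : LinearMap.ker k = ⊥ := by
      refine hS.eq_bot_of_disjoint (P := LinearMap.range g) ?_ ?_
      · rw [Submodule.disjoint_def]
        rintro _ ⟨y, rfl⟩ hy
        rw [LinearMap.mem_ker, hk] at hy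
        rw [show y = 0 from hy, map_zero]
      · rw [LinearMap.range_eq_map]
        exact Submodule.map_ne_bot_of_injective hg fun h0 => hT'.1 (eq_top_iff.2 (h0 ▸ bot_le))
    have hproj : Module.Projective Rᵐᵒᵖ (principalRightIdeal (e i)) := by
      have hmem : ∀ r : R, e i * r ∈ principalRightIdeal (e i) := fun r =>
        mem_principalRightIdeal.2 ⟨r, rfl⟩
      have hR : Module.Projective Rᵐᵒᵖ R :=
        Module.Projective.of_equiv (show Rᵐᵒᵖ ≃ₗ[Rᵐᵒᵖ] R from
          { toFun := MulOpposite.unop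
            invFun := MulOpposite.op
            map_add' := fun _ _ => rfl
            map_smul' := fun _ _ => rfl
            left_inv := fun _ => rfl
            right_inv := fun _ => rfl })
      refine Module.Projective.of_split (principalRightIdeal (e i)).subtype
        { toFun := fun r => ⟨e i * r, hmem r⟩
          map_add' := fun a b => Subtype.ext (mul_add _ a b)
          map_smul' := fun a b => Subtype.ext (mul_assoc _ b a.unop).symm } ?_
      refine LinearMap.ext fun x => Subtype.ext ?_
      obtain ⟨r, hr⟩ := mem_principalRightIdeal.1 x.2
      change e i * (x : R) = x
      rw [hr, ← mul_assoc, (he.idem i).eq]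
    exact Module.Projective.of_equiv (LinearEquiv.ofBijective k
      ⟨LinearMap.ker_eq_bot.1 hker, fun y => ⟨g y, hk y⟩⟩).symm

end RightIdeals

theorem corollary2p1 (R : Type u) [Ring R] :
    List.TFAE [
      IsRightAlmostVRing R,
      ∀ (M : Type u) [AddCommGroup M] [Module Rᵐᵒᵖ M],
        IsVModule Rᵐᵒᵖ M ∨
          ∃ P : Submodule Rᵐᵒᵖ M, P ≠ ⊥ ∧ (∃ Q : Submodule Rᵐᵒᵖ M, IsCompl P Q) ∧
            Module.Projective Rᵐᵒᵖ P,
      ∃ (I : Type u) (e : I → R), OrthogonalIdempotents e ∧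
        (∀ i, IsLocalModule Rᵐᵒᵖ (principalRightIdeal (e i)) ∧
          Module.Injective Rᵐᵒᵖ (principalRightIdeal (e i)) ∧
          Module.length Rᵐᵒᵖ (principalRightIdeal (e i)) = 2) ∧
        (iSupIndep (fun i => radicalOf (principalRightIdeal (e i))) ∧
          Module.jacobson Rᵐᵒᵖ R = ⨆ i, radicalOf (principalRightIdeal (e i))) ∧
        IsRightVRing (R ⧸ Ring.jacobson R)] := by
  tfae_have 1 → 2 := fun h =>
    monolithicProjective_iff_isVModule_or_exists_summand.1
      (monolithicProjective_of_almostInjective h)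
  tfae_have 2 → 3 := fun h =>
    (monolithicProjective_iff_isVModule_or_exists_summand.2 h).exists_orthogonalIdempotents
  tfae_have 3 → 1 := by
    rintro ⟨I, e, he, hP, ⟨-, hJ⟩, hV⟩
    exact (monolithicProjective_of_orthogonalIdempotents he (fun i => (hP i).1)
      (fun i => (hP i).2.1) (fun i => (hP i).2.2) hJ hV).isAlmostInjective
  tfae_finish
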